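/- **Setting.** Let $\sigma(u)=1/(1+e^{-u})$ with derivative $\dot\sigma$, and let items $i\in\mathcal I$ have attributes $x_i\in\mathbb R^d$, $d\ge 1$; write $z_{ij}=x_i-x_j$. Let $\theta_*\in\mathbb R^d$. Over rounds $s=1,\dots,T$ ($T\ge 1$) a learner chooses a pair $(i_s,j_s)$, adaptively and possibly at random, and then receives feedback $c_s\in\{0,1\}$. Given the earlier rounds, the chosen pair and any randomness used by the learner so far, $c_s=1$ has probability $\sigma(z_s^\top\theta_*)$, where $z_s=z_{i_sj_s}$. Put $$\mathbf H_T(\theta)=\sum_{s=1}^T\dot\sigma(z_s^\top\theta)\,z_sz_s^\top,\qquad \tilde{\mathbf H}_T(\theta)=\tfrac1T\mathbf H_T(\theta),\qquad \|v\|_V=\sqrt{v^\top Vv},$$ and let $\theta_T$ be a random vector. Call $\theta_T$ a maximum-likelihood estimate (MLE) at an outcome if it maximizes $\theta\mapsto\sum_{s=1}^T\big(c_s\log\sigma(z_s^\top\theta)+(1-c_s)\log(1-\sigma(z_s^\top\theta))\big)$ over $\mathbb R^d$ there. **Lemma (Concentration Lemma).** For all $S,\lambda_0,Q>0$ there is a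 constant $C_1>0$, depending only on $S,\lambda_0,Q$, such that the following holds for all $d$, $T$ and every setting as above with $\|\theta_*\|_2\le S$ and $\|x_k\|_2\le Q$ for all $k\in\mathcal I$. For items $i,j\in\mathcal I$ and $\Delta>0$ let $$\alpha_{ij}(\Delta)=\exp\!\Big(\frac{-\Delta^2T}{8dC_1\big(\dot\sigma(z_{ij}^\top\theta_T)\,\|z_{ij}\|_{\tilde{\mathbf H}_T^{-1}(\theta_T)}\big)^2}\Big),\qquad \beta_{ij}(\Delta)=\exp\!\Big(\frac{-\Delta T}{dC_1\|z_{ij}\|^2_{\tilde{\mathbf H}_T^{-1}(\theta_T)}}\Big).$$ These depend on the observed data and on $\theta_T$, but not on $\theta_*$. Let $G$ be the event that $\theta_T$ is an MLE and that $\mathbf H_T(\theta_T)$ and $\mathbf H_T(\theta_*)$ both have full rank with all eigenvalues larger than $\lambda_0$. Then for all real numbers $\alpha,\beta\in\big(0,\tfrac1{4dT}\big]$, $$P\Big(G,\ \ \alpha_{ij}(\Delta)\le\alpha,\ \ \beta_{ij}(\Delta)\le\beta,\ \ |\sigma(z_{ij}^\top\theta_*)-\sigma(z_{ij}^\top\theta_T)|>\Delta\Big)\le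 2dT(\alpha+\beta).$$ (For $z_{ij}=0$ the probability is $0$.) -/

import Mathlib

open MeasureTheory ProbabilityTheory

noncomputable section

namespace PrefOrder

variable {d : ℕ}

/-- The log-likelihood of a parameter `θ` after `T` rounds with attribute differences `z s` and
binary feedback `c s` (`s < T`), under the logistic model. -/
def logLik (T : ℕ) (z : ℕ → EuclideanSpace ℝ (Fin d)) (c : ℕ → ℝ)
    (θ : EuclideanSpace ℝ (Fin d)) : ℝ :=
  ∑ s ∈ Finset.range T,
    (c s * Real.log (Real.sigmoid (inner ℝ (z s) θ))
      + (1 - c s) * Real.log (1 - Real.sigmoid (inner ℝ (z s) θ)))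

/-- `θ` is a maximum-likelihood estimate (over the whole space). -/
def IsMLE (T : ℕ) (z : ℕ → EuclideanSpace ℝ (Fin d)) (c : ℕ → ℝ)
    (θ : EuclideanSpace ℝ (Fin d)) : Prop :=
  ∀ θ' : EuclideanSpace ℝ (Fin d), logLik T z c θ' ≤ logLik T z c θ

/-- The observed Fisher information `H_T(θ) = ∑_{s < T} σ'(z_sᵀ θ) z_s z_sᵀ`. -/
def hessian (T : ℕ) (z : ℕ → EuclideanSpace ℝ (Fin d)) (θ : EuclideanSpace ℝ (Fin d)) :
    Matrix (Fin d) (Fin d) ℝ :=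
  ∑ s ∈ Finset.range T,
    deriv Real.sigmoid (inner ℝ (z s) θ) • Matrix.vecMulVec (z s).ofLp (z s).ofLp

/-- The normalized observed Fisher information `(1 / T) H_T(θ)`. -/
def normHessian (T : ℕ) (z : ℕ → EuclideanSpace ℝ (Fin d)) (θ : EuclideanSpace ℝ (Fin d)) :
    Matrix (Fin d) (Fin d) ℝ :=
  (1 / (T : ℝ)) • hessian T z θ

/-- The weighted norm `‖v‖_V = √(vᵀ V v)`. -/
def weightedNorm (V : Matrix (Fin d) (Fin d) ℝ) (v : EuclideanSpace ℝ (Fin d)) : ℝ :=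
  Real.sqrt (v.ofLp ⬝ᵥ V.mulVec v.ofLp)

/-- The matrix has full rank and all its eigenvalues are larger than `lam`. -/
def FullRankEigenvaluesGT (H : Matrix (Fin d) (Fin d) ℝ) (lam : ℝ) : Prop :=
  H.rank = d ∧ ∀ ev : ℝ, Module.End.HasEigenvalue (Matrix.toLin' H) ev → lam < ev

/-- The first-order term for a pair with attribute difference `v`, at the parameter `θ`. -/
def alphaTerm (C₁ : ℝ) (T : ℕ) (z : ℕ → EuclideanSpace ℝ (Fin d))
    (θ v : EuclideanSpace ℝ (Fin d)) (Δ : ℝ) : ℝ :=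
  Real.exp (-(Δ ^ 2 * T) /
    (8 * d * C₁ *
      (deriv Real.sigmoid (inner ℝ v θ) * weightedNorm (normHessian T z θ)⁻¹ v) ^ 2))

/-- The second-order term for a pair with attribute difference `v`, at the parameter `θ`. -/
def betaTerm (C₁ : ℝ) (T : ℕ) (z : ℕ → EuclideanSpace ℝ (Fin d))
    (θ v : EuclideanSpace ℝ (Fin d)) (Δ : ℝ) : ℝ :=
  Real.exp (-(Δ * T) / (d * C₁ * weightedNorm (normHessian T z θ)⁻¹ v ^ 2))

/-- The attribute difference `z_s = x_{i_s} - x_{j_s}` of the pair compared in round `s`, for the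
outcome `ω`. -/
def pairDiff {I Ω : Type*} (x : I → EuclideanSpace ℝ (Fin d)) (it jt : ℕ → Ω → I) (ω : Ω) (s : ℕ) :
    EuclideanSpace ℝ (Fin d) :=
  x (it s ω) - x (jt s ω)

/-- `T` rounds of active preference learning. The round `t < T` compares the items `it t`, `jt t`;
`ℱ t` is the information available once this pair is chosen and before its feedback `c t` is seen:
it contains all earlier rounds, and possibly randomness used by the learner. Given `ℱ t`, the
feedback is a Bernoulli variable with the logistic success probability `σ(z_tᵀ θstar)`. -/
structure IsActiveLearning {I Ω : Type*} [mΩ : MeasurableSpace Ω] (μ : Measure Ω) (T : ℕ)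
    (x : I → EuclideanSpace ℝ (Fin d)) (θstar : EuclideanSpace ℝ (Fin d))
    (ℱ : Filtration ℕ mΩ) (it jt : ℕ → Ω → I) (c : ℕ → Ω → ℝ) : Prop where
  measurable_fst : ∀ t < T, Measurable[ℱ t] fun ω => x (it t ω)
  measurable_snd : ∀ t < T, Measurable[ℱ t] fun ω => x (jt t ω)
  measurable_feedback : ∀ t < T, Measurable[ℱ (t + 1)] (c t)
  binary : ∀ t < T, ∀ ω, c t ω = 0 ∨ c t ω = 1
  feedback : ∀ t < T, μ⟦{ω | c t ω = 1} | ℱ t⟧ =ᵐ[μ]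
    fun ω => Real.sigmoid (inner ℝ (pairDiff x it jt ω t) θstar)

end PrefOrder

end

open MeasureTheory ProbabilityTheory

namespace PrefOrder

/-! The probability enters only through likelihood ratios. For fixed `θ`, the exponential of `logLik
θ - logLik θstar` has mean one under any adaptive choice of pairs
(`IsActiveLearning.likelihoodRatio`). Markov's inequality and a union bound over a grid, extended by
the Lipschitz property of the log-likelihood, bound the gain over `θstar` on a whole ball of radius
`A T` by a constant times `d log (1 / g)`, outside an event of probability at most `g`
(`IsActiveLearning.exists_logLik_sub_le`). The entropy of the grid is of order `d log (d T)`, and `g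
≤ 1 / (4 d T)` absorbs it.

The rest is deterministic. The log-likelihood at the midpoint of `θT` and `θstar` exceeds the
average of its two end values by a sum of Jensen gaps of `log (1 + exp u)`. Since `θT` maximizes,
these gaps are at most the gain of the midpoint over `θstar`. Each gap dominates the squared
predictor difference weighted by the Fisher information at `θT`, with a constant depending only on
the bound for the predictors at `θstar` (`deriv_sigmoid_mul_sq_sub_le_gap`); so no uniform bound on
`θT` is needed there. The eigenvalue bound at `θT` places the midpoint in the ball. Cauchy-Schwarz
in the Fisher geometry and a second-order expansion of the sigmoid convert the weighted error into
an error below `Δ`.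

With `g = max a b` this bounds the probability by `max a b`, which is below the stated bound. -/

/-! ### Scalar inequalities for the logistic function -/

theorem sigmoid_eq_exp_div (u : ℝ) : Real.sigmoid u = Real.exp u / (1 + Real.exp u) := by
  rw [Real.sigmoid_def, Real.exp_neg]
  have := Real.exp_pos u
  field_simp
  ring

theorem one_sub_sigmoid_eq (u : ℝ) : 1 - Real.sigmoid u = 1 / (1 + Real.exp u) := by
  rw [sigmoid_eq_exp_div]
  have := Real.exp_pos u
  field_simp
  ring

theorem log_sigmoid (u : ℝ) : Real.log (Real.sigmoid u) = u - Real.log (1 + Real.exp u) := by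
  have := Real.exp_pos u
  rw [sigmoid_eq_exp_div, Real.log_div (by positivity) (by positivity), Real.log_exp]

theorem log_one_sub_sigmoid (u : ℝ) :
    Real.log (1 - Real.sigmoid u) = - Real.log (1 + Real.exp u) := by
  rw [one_sub_sigmoid_eq, one_div, Real.log_inv]

theorem deriv_sigmoid_eq (u : ℝ) :
    deriv Real.sigmoid u = Real.exp u / (1 + Real.exp u) ^ 2 := by
  have := Real.exp_pos u
  rw [Real.deriv_sigmoid]
  simp only [one_sub_sigmoid_eq]
  rw [sigmoid_eq_exp_div]
  field_simp

theorem deriv_sigmoid_pos (u : ℝ) : 0 < deriv Real.sigmoid u := by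
  rw [deriv_sigmoid_eq]
  have := Real.exp_pos u
  positivity

theorem log_one_add_exp_sub_le (u v : ℝ) :
    Real.log (1 + Real.exp u) - Real.log (1 + Real.exp v) ≤ max (u - v) 0 := by
  have hu := Real.exp_pos u
  have hv := Real.exp_pos v
  rw [sub_le_iff_le_add, ← Real.log_exp (max (u - v) 0),
    ← Real.log_mul (by positivity) (by positivity)]
  apply Real.log_le_log (by positivity)
  have h1 : 1 ≤ Real.exp (max (u - v) 0) := Real.one_le_exp (le_max_right _ _)
  have h2 : Real.exp u ≤ Real.exp (max (u - v) 0) * Real.exp v := by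
    rw [← Real.exp_add]
    apply Real.exp_le_exp.2
    linarith [le_max_left (u - v) 0]
  linarith

/-- The log-likelihood of binary feedback is 1-Lipschitz in the linear predictor. -/
theorem log_bernoulli_sub_le {c : ℝ} (hc : c = 0 ∨ c = 1) (u v : ℝ) :
    (c * u - Real.log (1 + Real.exp u)) - (c * v - Real.log (1 + Real.exp v)) ≤ |u - v| := by
  have h := log_one_add_exp_sub_le v u
  rcases hc with rfl | rfl
  · have : max (v - u) 0 ≤ |u - v| :=
      max_le (by rw [abs_sub_comm]; exact le_abs_self _) (abs_nonneg _)
    linarith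
  · have : max (v - u) 0 = max (u - v) 0 - (u - v) := by
      rcases le_total u v with h | h
      · rw [max_eq_left (by linarith), max_eq_right (by linarith)]; ring
      · rw [max_eq_right (by linarith), max_eq_left (by linarith)]; ring
    have : max (u - v) 0 ≤ |u - v| := max_le (le_abs_self _) (abs_nonneg _)
    linarith

theorem abs_sigmoid_sub_le (u v : ℝ) : |Real.sigmoid u - Real.sigmoid v| ≤ |u - v| := by
  have h := Convex.norm_image_sub_le_of_norm_deriv_le (f := Real.sigmoid) (C := 1) (s := Set.univ)
    (x := v) (y := u) (fun x _ => differentiable_sigmoid.differentiableAt)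
    (fun x _ => by
      rw [Real.norm_of_nonneg (deriv_sigmoid_pos x).le, Real.deriv_sigmoid]
      have h0 := Real.sigmoid_pos x
      have h1 := Real.sigmoid_lt_one x
      show Real.sigmoid x * (1 - Real.sigmoid x) ≤ 1
      nlinarith)
    convex_univ (Set.mem_univ _) (Set.mem_univ _)
  simpa using h

theorem abs_deriv_sigmoid_sub_le (u v : ℝ) :
    |deriv Real.sigmoid u - deriv Real.sigmoid v| ≤ |u - v| := by
  have h := abs_sigmoid_sub_le u v
  simp only [Real.deriv_sigmoid]
  have h0 := Real.sigmoid_pos u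
  have h1 := Real.sigmoid_lt_one u
  have h2 := Real.sigmoid_pos v
  have h3 := Real.sigmoid_lt_one v
  have : Real.sigmoid u * (1 - Real.sigmoid u) - Real.sigmoid v * (1 - Real.sigmoid v)
      = (Real.sigmoid u - Real.sigmoid v) * (1 - Real.sigmoid u - Real.sigmoid v) := by ring
  rw [this, abs_mul]
  have h4 : |1 - Real.sigmoid u - Real.sigmoid v| ≤ 1 := by
    rw [abs_le]; constructor <;> linarith
  calc _ ≤ |Real.sigmoid u - Real.sigmoid v| * 1 := by gcongr
    _ ≤ _ := by linarith

/-- The derivative is 1-Lipschitz, so between `v` and `u` it is at most its value at `v` plus `|u -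
v|`. The point `v` is later the predictor at the estimate, where `alphaTerm` evaluates the
derivative. -/
theorem abs_sigmoid_sub_le_deriv (u v : ℝ) :
    |Real.sigmoid u - Real.sigmoid v| ≤ deriv Real.sigmoid v * |u - v| + (u - v) ^ 2 := by
  have h := Convex.norm_image_sub_le_of_norm_deriv_le (f := Real.sigmoid)
    (C := deriv Real.sigmoid v + |u - v|) (s := Set.uIcc v u)
    (x := v) (y := u) (fun x _ => differentiable_sigmoid.differentiableAt)
    (fun x hx => by
      rw [Real.norm_of_nonneg (deriv_sigmoid_pos x).le]
      have h1 := (le_abs_self _).trans (abs_deriv_sigmoid_sub_le x v)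
      have h2 : |x - v| ≤ |u - v| := Set.abs_sub_left_of_mem_uIcc hx
      linarith)
    (convex_uIcc v u) Set.left_mem_uIcc Set.right_mem_uIcc
  simp only [Real.norm_eq_abs] at h
  rw [add_mul, abs_mul_abs_self, ← sq] at h
  exact h

/-- The exponential decay of the derivative beats `u ^ 2`. Summed over rounds, this bounds the
Fisher quadratic form of `θ` at `θ` itself, and thereby the norm of the estimate. -/
theorem deriv_sigmoid_mul_sq_le_two (u : ℝ) : deriv Real.sigmoid u * u ^ 2 ≤ 2 := by
  have h := Real.exp_pos u
  have h1 : u ^ 2 * Real.exp u ≤ 2 * (1 + Real.exp u) ^ 2 := by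
    have key : ∀ x : ℝ, 0 ≤ x → x ^ 2 ≤ 2 * Real.exp x := fun x hx => by
      have := Real.quadratic_le_exp_of_nonneg hx
      nlinarith
    rcases le_total 0 u with hu | hu
    · have := key u hu
      nlinarith
    · have h2 := key (-u) (by linarith)
      have h3 : Real.exp (-u) * Real.exp u = 1 := by rw [← Real.exp_add]; simp
      nlinarith
  rw [deriv_sigmoid_eq, div_mul_eq_mul_div, div_le_iff₀ (by positivity)]
  linarith

/-- With `r = (b - u) / 2 ≥ 0` this is `r ≤ exp r - 1`, squared and multiplied by `4 exp u`. -/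
theorem sq_sub_mul_exp_le (u b : ℝ) (h : u ≤ b) :
    (u - b) ^ 2 * Real.exp u ≤ 4 * (Real.exp (u / 2) - Real.exp (b / 2)) ^ 2 := by
  have h1 : Real.exp (b / 2) = Real.exp (u / 2) * Real.exp ((b - u) / 2) := by
    rw [← Real.exp_add]; ring_nf
  have h2 : Real.exp u = Real.exp (u / 2) ^ 2 := by
    rw [← Real.exp_nat_mul]; congr 1; push_cast; ring
  have h3 := Real.add_one_le_exp ((b - u) / 2)
  have h4 : ((b - u) / 2) ^ 2 ≤ (Real.exp ((b - u) / 2) - 1) ^ 2 :=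
    pow_le_pow_left₀ (by linarith) (by linarith) 2
  rw [h1, h2]
  have := mul_le_mul_of_nonneg_right h4 (sq_nonneg (Real.exp (u / 2)))
  nlinarith

/-- The Jensen gap of the log-partition function of the logistic model controls the squared
difference of the linear predictors, weighted by the Fisher information at the first one. -/
theorem deriv_sigmoid_mul_sq_sub_le_gap {B b : ℝ} (hb : |b| ≤ B) (u : ℝ) :
    deriv Real.sigmoid u * (u - b) ^ 2 ≤
      8 * (1 + Real.exp B) * (Real.log (1 + Real.exp u) / 2 + Real.log (1 + Real.exp b) / 2
        - Real.log (1 + Real.exp ((u + b) / 2))) := by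
  set p := Real.exp (u / 2) with hp
  set q := Real.exp (b / 2) with hq
  have hp0 : 0 < p := Real.exp_pos _
  have hq0 : 0 < q := Real.exp_pos _
  have hu : Real.exp u = p ^ 2 := by rw [hp, ← Real.exp_nat_mul]; congr 1; push_cast; ring
  have hbq : Real.exp b = q ^ 2 := by rw [hq, ← Real.exp_nat_mul]; congr 1; push_cast; ring
  have hm : Real.exp ((u + b) / 2) = p * q := by rw [hp, hq, ← Real.exp_add]; ring_nf
  have hEB : q ^ 2 ≤ Real.exp B := by
    rw [← hbq]; exact Real.exp_le_exp.2 ((le_abs_self b).trans hb)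
  have hEB' : 1 ≤ Real.exp B * q ^ 2 := by
    rw [← hbq, ← Real.exp_add]; exact Real.one_le_exp (by linarith [neg_abs_le b])
  -- the logarithmic lower bound
  have hlog : (p - q) ^ 2 / ((1 + p ^ 2) * (1 + q ^ 2)) ≤
      Real.log (1 + p ^ 2) + Real.log (1 + q ^ 2) - 2 * Real.log (1 + p * q) := by
    -- The bound `1 - 1 / t ≤ log t` is exact enough because `(1 + p ^ 2) (1 + q ^ 2) - (1 + p q) ^
    -- 2 = (p - q) ^ 2`.
    have h1 := Real.one_sub_inv_le_log_of_pos
      (x := (1 + p ^ 2) * (1 + q ^ 2) / (1 + p * q) ^ 2) (by positivity)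
    rw [Real.log_div (by positivity) (by positivity), Real.log_mul (by positivity) (by positivity),
      Real.log_pow] at h1
    refine le_trans (le_of_eq ?_) h1
    field_simp
    ring
  -- The exponential estimate carries the smaller of the weights `p ^ 2`, `q ^ 2`. If that is `q ^
  -- 2`, trading `p ^ 2` for it uses `1 ≤ exp B * q ^ 2`, so only `b` has to be bounded.
  have hmain : (u - b) ^ 2 * p ^ 2 * (1 + q ^ 2) ≤
      4 * (1 + Real.exp B) * (p - q) ^ 2 * (1 + p ^ 2) := by
    rcases le_total u b with h | h
    · have h1 := sq_sub_mul_exp_le u b h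
      rw [hu] at h1
      have h2 : 1 + q ^ 2 ≤ (1 + Real.exp B) * (1 + p ^ 2) := by
        nlinarith [Real.exp_pos B, sq_nonneg p]
      calc _ ≤ 4 * (p - q) ^ 2 * ((1 + Real.exp B) * (1 + p ^ 2)) :=
            mul_le_mul h1 h2 (by positivity) (by positivity)
        _ = _ := by ring
    · have h1 := sq_sub_mul_exp_le b u h
      rw [hbq] at h1
      have h2 : p ^ 2 * (1 + q ^ 2) ≤ q ^ 2 * ((1 + Real.exp B) * (1 + p ^ 2)) := by
        nlinarith [Real.exp_pos B, sq_nonneg p, sq_nonneg q,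
          mul_nonneg (sub_nonneg.2 hEB') (sq_nonneg p)]
      have h3 : 0 ≤ (u - b) ^ 2 := sq_nonneg _
      calc _ = (u - b) ^ 2 * (p ^ 2 * (1 + q ^ 2)) := by ring
        _ ≤ (u - b) ^ 2 * (q ^ 2 * ((1 + Real.exp B) * (1 + p ^ 2))) := by gcongr
        _ = ((b - u) ^ 2 * q ^ 2) * ((1 + Real.exp B) * (1 + p ^ 2)) := by ring
        _ ≤ (4 * (q - p) ^ 2) * ((1 + Real.exp B) * (1 + p ^ 2)) := by
          gcongr
        _ = _ := by ring
  rw [deriv_sigmoid_eq, hu, hbq, hm]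
  have hfin : p ^ 2 / (1 + p ^ 2) ^ 2 * (u - b) ^ 2 ≤
      4 * (1 + Real.exp B) * ((p - q) ^ 2 / ((1 + p ^ 2) * (1 + q ^ 2))) := by
    rw [div_mul_eq_mul_div, mul_div_assoc', div_le_div_iff₀ (by positivity) (by positivity)]
    have := mul_le_mul_of_nonneg_right hmain (show 0 ≤ 1 + p ^ 2 by positivity)
    nlinarith
  have := mul_le_mul_of_nonneg_left hlog (show 0 ≤ 4 * (1 + Real.exp B) by positivity)
  linarith

/-! ### Quadratic forms of the Fisher information -/

variable {d : ℕ}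

theorem dotProduct_vecMulVec_mulVec (w x y : Fin d → ℝ) :
    x ⬝ᵥ (Matrix.vecMulVec w w).mulVec y = (w ⬝ᵥ x) * (w ⬝ᵥ y) := by
  rw [Matrix.vecMulVec_mulVec, op_smul_eq_smul, dotProduct_smul, smul_eq_mul, mul_comm,
    dotProduct_comm x w]

theorem inner_eq_dotProduct_ofLp (x y : EuclideanSpace ℝ (Fin d)) :
    inner ℝ x y = x.ofLp ⬝ᵥ y.ofLp := by
  rw [EuclideanSpace.inner_eq_star_dotProduct, star_trivial, dotProduct_comm]

theorem dotProduct_hessian_mulVec (T : ℕ) (z : ℕ → EuclideanSpace ℝ (Fin d))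
    (θ x y : EuclideanSpace ℝ (Fin d)) :
    x.ofLp ⬝ᵥ (hessian T z θ).mulVec y.ofLp =
      ∑ s ∈ Finset.range T,
        deriv Real.sigmoid (inner ℝ (z s) θ) * (inner ℝ (z s) x * inner ℝ (z s) y) := by
  rw [hessian, Matrix.sum_mulVec, dotProduct_sum]
  refine Finset.sum_congr rfl fun s _ => ?_
  rw [Matrix.smul_mulVec, dotProduct_smul, dotProduct_vecMulVec_mulVec, smul_eq_mul,
    inner_eq_dotProduct_ofLp (z s) x, inner_eq_dotProduct_ofLp (z s) y]

theorem isHermitian_hessian (T : ℕ) (z : ℕ → EuclideanSpace ℝ (Fin d))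
    (θ : EuclideanSpace ℝ (Fin d)) : (hessian T z θ).IsHermitian := by
  rw [Matrix.IsHermitian, hessian, Matrix.conjTranspose_sum]
  refine Finset.sum_congr rfl fun s _ => ?_
  rw [Matrix.conjTranspose_smul, star_trivial, Matrix.conjTranspose_vecMulVec]
  simp

/-- A symmetric matrix whose eigenvalues exceed `lam` has quadratic form at least `lam ‖x‖²`. -/
theorem mul_dotProduct_le_of_fullRankEigenvaluesGT {H : Matrix (Fin d) (Fin d) ℝ} {lam : ℝ}
    (hH : H.IsHermitian) (h : FullRankEigenvaluesGT H lam) (x : Fin d → ℝ) :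
    lam * (x ⬝ᵥ x) ≤ x ⬝ᵥ H.mulVec x := by
  have hB : (H - lam • (1 : Matrix (Fin d) (Fin d) ℝ)).IsHermitian := by
    apply hH.sub
    simp [Matrix.IsHermitian]
  have hpsd := hB.posSemidef_iff_eigenvalues_nonneg.2 (fun k => by
    have hk := hB.mulVec_eigenvectorBasis k
    have hev : Module.End.HasEigenvalue (Matrix.toLin' H) (hB.eigenvalues k + lam) := by
      refine Module.End.hasEigenvalue_of_hasEigenvector
        (x := (hB.eigenvectorBasis k).ofLp) ⟨Module.End.mem_eigenspace_iff.2 ?_, ?_⟩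
      · rw [Matrix.sub_mulVec, Matrix.smul_mulVec, Matrix.one_mulVec, sub_eq_iff_eq_add] at hk
        rw [Matrix.toLin'_apply, hk, add_smul]
      · intro h0
        apply hB.eigenvectorBasis.orthonormal.ne_zero k
        ext i
        exact congrFun h0 i
    have := h.2 _ hev
    show 0 ≤ hB.eigenvalues k
    linarith)
  have := hpsd.dotProduct_mulVec_nonneg x
  rw [star_trivial, Matrix.sub_mulVec, Matrix.smul_mulVec, Matrix.one_mulVec, dotProduct_sub,
    dotProduct_smul, smul_eq_mul] at this
  linarith

theorem isUnit_det_of_fullRankEigenvaluesGT {H : Matrix (Fin d) (Fin d) ℝ} {lam : ℝ}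
    (hH : H.IsHermitian) (hlam : 0 < lam) (h : FullRankEigenvaluesGT H lam) : IsUnit H.det := by
  rw [← Matrix.isUnit_iff_isUnit_det, ← Matrix.mulVec_injective_iff_isUnit]
  intro x y hxy
  have h0 : H.mulVec (x - y) = 0 := by rw [Matrix.mulVec_sub, sub_eq_zero]; exact hxy
  have h1 := mul_dotProduct_le_of_fullRankEigenvaluesGT hH h (x - y)
  rw [h0, dotProduct_zero] at h1
  have h2 : (x - y) ⬝ᵥ (x - y) = 0 :=
    le_antisymm (nonpos_of_mul_nonpos_right h1 hlam)
      (Finset.sum_nonneg fun i _ => mul_self_nonneg _)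
  exact sub_eq_zero.1 (dotProduct_self_eq_zero.1 h2)

/-- The Cauchy-Schwarz inequality in the geometry of the Hessian. -/
theorem inner_sq_le_weightedNorm_inv_sq_mul {T : ℕ} {z : ℕ → EuclideanSpace ℝ (Fin d)}
    {θ : EuclideanSpace ℝ (Fin d)} (hdet : IsUnit (hessian T z θ).det)
    (v x : EuclideanSpace ℝ (Fin d)) :
    (inner ℝ v x) ^ 2 ≤ weightedNorm (hessian T z θ)⁻¹ v ^ 2 *
      ∑ s ∈ Finset.range T, deriv Real.sigmoid (inner ℝ (z s) θ) * (inner ℝ (z s) x) ^ 2 := by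
  set H := hessian T z θ with hHdef
  set y : EuclideanSpace ℝ (Fin d) := WithLp.toLp 2 (H⁻¹.mulVec v.ofLp) with hy
  have hv : v.ofLp = H.mulVec y.ofLp := by
    rw [hy, Matrix.mulVec_mulVec, Matrix.mul_nonsing_inv _ hdet, Matrix.one_mulVec]
  have h1 : inner ℝ v x = x.ofLp ⬝ᵥ H.mulVec y.ofLp := by
    rw [inner_eq_dotProduct_ofLp, ← hv, dotProduct_comm]
  have h2 : v.ofLp ⬝ᵥ H⁻¹.mulVec v.ofLp = y.ofLp ⬝ᵥ H.mulVec y.ofLp := by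
    rw [← hv, dotProduct_comm]
  have h3 : 0 ≤ y.ofLp ⬝ᵥ H.mulVec y.ofLp := by
    rw [hHdef, dotProduct_hessian_mulVec]
    exact Finset.sum_nonneg fun s _ => mul_nonneg (deriv_sigmoid_pos _).le (mul_self_nonneg _)
  rw [weightedNorm, h2, Real.sq_sqrt h3, h1, hHdef, dotProduct_hessian_mulVec,
    dotProduct_hessian_mulVec, mul_comm (Finset.sum _ _)]
  have hcs := Finset.sum_mul_sq_le_sq_mul_sq (Finset.range T)
    (fun s => Real.sqrt (deriv Real.sigmoid (inner ℝ (z s) θ)) * inner ℝ (z s) x)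
    (fun s => Real.sqrt (deriv Real.sigmoid (inner ℝ (z s) θ)) * inner ℝ (z s) y)
  have hs : ∀ s, Real.sqrt (deriv Real.sigmoid (inner ℝ (z s) θ)) ^ 2
      = deriv Real.sigmoid (inner ℝ (z s) θ) := fun s => Real.sq_sqrt (deriv_sigmoid_pos _).le
  simp only [mul_pow, hs] at hcs
  refine le_trans (le_of_eq ?_) (hcs.trans (le_of_eq ?_))
  · congr 1
    refine Finset.sum_congr rfl fun s _ => ?_
    linear_combination (-(inner ℝ (z s) x * inner ℝ (z s) y)) * hs s
  · congr 1
    refine Finset.sum_congr rfl fun s _ => ?_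
    ring

theorem weightedNorm_inv_normHessian_sq {T : ℕ} (hT : 1 ≤ T) {z : ℕ → EuclideanSpace ℝ (Fin d)}
    {θ : EuclideanSpace ℝ (Fin d)} (hdet : IsUnit (hessian T z θ).det)
    (v : EuclideanSpace ℝ (Fin d)) :
    weightedNorm (normHessian T z θ)⁻¹ v ^ 2 = T * weightedNorm (hessian T z θ)⁻¹ v ^ 2 := by
  have hT0 : (0 : ℝ) < T := by exact_mod_cast hT
  have hinv : (normHessian T z θ)⁻¹ = (T : ℝ) • (hessian T z θ)⁻¹ := by
    apply Matrix.inv_eq_right_inv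
    rw [normHessian, smul_mul_smul_comm, Matrix.mul_nonsing_inv _ hdet, one_div,
      inv_mul_cancel₀ hT0.ne', one_smul]
  rw [hinv]
  unfold weightedNorm
  rw [Matrix.smul_mulVec, dotProduct_smul, smul_eq_mul, Real.sqrt_mul hT0.le, mul_pow,
    Real.sq_sqrt hT0.le]

/-- The Fisher information at `θ` bounds the norm of `θ` when its eigenvalues exceed `lam`. -/
theorem mul_norm_sq_le_of_fullRankEigenvaluesGT {T : ℕ} {z : ℕ → EuclideanSpace ℝ (Fin d)}
    {θ : EuclideanSpace ℝ (Fin d)} {lam : ℝ} (h : FullRankEigenvaluesGT (hessian T z θ) lam) :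
    lam * ‖θ‖ ^ 2 ≤ 2 * T := by
  have h1 := mul_dotProduct_le_of_fullRankEigenvaluesGT (isHermitian_hessian T z θ) h θ.ofLp
  rw [← inner_eq_dotProduct_ofLp, real_inner_self_eq_norm_sq, dotProduct_hessian_mulVec] at h1
  refine h1.trans ?_
  calc _ ≤ ∑ s ∈ Finset.range T, (2 : ℝ) := by
        refine Finset.sum_le_sum fun s _ => ?_
        rw [← sq]
        exact deriv_sigmoid_mul_sq_le_two _
    _ = _ := by simp [mul_comm]

/-! ### The log-likelihood and its maximizers -/

theorem logLik_eq (T : ℕ) (z : ℕ → EuclideanSpace ℝ (Fin d)) (c : ℕ → ℝ)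
    (θ : EuclideanSpace ℝ (Fin d)) :
    logLik T z c θ = ∑ s ∈ Finset.range T,
      (c s * inner ℝ (z s) θ - Real.log (1 + Real.exp (inner ℝ (z s) θ))) := by
  refine Finset.sum_congr rfl fun s _ => ?_
  rw [log_sigmoid, log_one_sub_sigmoid]
  ring

/-- Each round is 1-Lipschitz in its predictor. This makes likelihood ratios bounded, hence
integrable, and later carries the grid bound over to the ball. -/
theorem logLik_sub_le {T : ℕ} {z : ℕ → EuclideanSpace ℝ (Fin d)} {c : ℕ → ℝ} {M : ℝ}
    (hc : ∀ s < T, c s = 0 ∨ c s = 1) (hz : ∀ s, ‖z s‖ ≤ M) (θ θ' : EuclideanSpace ℝ (Fin d)) :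
    logLik T z c θ - logLik T z c θ' ≤ T * (M * ‖θ - θ'‖) := by
  rw [logLik_eq, logLik_eq, ← Finset.sum_sub_distrib]
  calc _ ≤ ∑ s ∈ Finset.range T, M * ‖θ - θ'‖ := by
        refine Finset.sum_le_sum fun s hs => ?_
        refine (log_bernoulli_sub_le (hc s (Finset.mem_range.1 hs)) _ _).trans ?_
        rw [← inner_sub_right]
        exact (abs_real_inner_le_norm _ _).trans (by gcongr; exact hz s)
    _ = _ := by simp

/-- The Fisher-weighted distance of a maximum-likelihood estimate to any parameter `θ₀` is
controlled by the gain in log-likelihood at the midpoint. -/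
theorem IsMLE.sum_deriv_sigmoid_mul_sq_le {T : ℕ} {z : ℕ → EuclideanSpace ℝ (Fin d)} {c : ℕ → ℝ}
    {θ θ₀ : EuclideanSpace ℝ (Fin d)} {B : ℝ} (h : IsMLE T z c θ)
    (hB : ∀ s, |inner ℝ (z s) θ₀| ≤ B) :
    ∑ s ∈ Finset.range T, deriv Real.sigmoid (inner ℝ (z s) θ) * (inner ℝ (z s) (θ - θ₀)) ^ 2 ≤
      8 * (1 + Real.exp B) *
        (logLik T z c ((1 / 2 : ℝ) • (θ + θ₀)) - logLik T z c θ₀) := by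
  calc _ ≤ ∑ s ∈ Finset.range T, 8 * (1 + Real.exp B) *
        ((c s * inner ℝ (z s) ((1 / 2 : ℝ) • (θ + θ₀))
            - Real.log (1 + Real.exp (inner ℝ (z s) ((1 / 2 : ℝ) • (θ + θ₀)))))
          - (c s * inner ℝ (z s) θ - Real.log (1 + Real.exp (inner ℝ (z s) θ))) / 2
          - (c s * inner ℝ (z s) θ₀ - Real.log (1 + Real.exp (inner ℝ (z s) θ₀))) / 2) := by
        refine Finset.sum_le_sum fun s _ => ?_
        rw [inner_sub_right]
        -- The terms linear in the predictor cancel at the midpoint, which leaves exactly the Jensen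
        -- gap, free of the feedback.
        refine (deriv_sigmoid_mul_sq_sub_le_gap (hB s) _).trans (le_of_eq ?_)
        rw [inner_smul_right, inner_add_right,
          show (1 / 2 : ℝ) * (inner ℝ (z s) θ + inner ℝ (z s) θ₀)
            = (inner ℝ (z s) θ + inner ℝ (z s) θ₀) / 2 by ring]
        ring
    _ = 8 * (1 + Real.exp B) * (logLik T z c ((1 / 2 : ℝ) • (θ + θ₀)) - logLik T z c θ / 2
          - logLik T z c θ₀ / 2) := by
        rw [← Finset.mul_sum, Finset.sum_sub_distrib, Finset.sum_sub_distrib, ← Finset.sum_div,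
          ← Finset.sum_div, ← logLik_eq, ← logLik_eq, ← logLik_eq]
    _ ≤ _ := by
        have := h θ₀
        refine mul_le_mul_of_nonneg_left (by linarith) (by positivity)

theorem norm_pairDiff_le {I Ω : Type*} {x : I → EuclideanSpace ℝ (Fin d)} {it jt : ℕ → Ω → I}
    {Q : ℝ} (hx : ∀ k, ‖x k‖ ≤ Q) (ω : Ω) (s : ℕ) :
    ‖pairDiff x it jt ω s‖ ≤ 2 * Q := by
  have h := norm_sub_le (x (it s ω)) (x (jt s ω))
  have h1 := hx (it s ω)
  have h2 := hx (jt s ω)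
  rw [pairDiff]
  linarith

/-! ### The likelihood ratio under adaptive sampling -/

section LikelihoodRatio

variable {I Ω : Type*} [mΩ : MeasurableSpace Ω] {μ : Measure Ω} {T : ℕ}
  {x : I → EuclideanSpace ℝ (Fin d)} {θstar : EuclideanSpace ℝ (Fin d)}
  {ℱ : Filtration ℕ mΩ} {it jt : ℕ → Ω → I} {c : ℕ → Ω → ℝ}

theorem IsActiveLearning.measurable_inner (h : IsActiveLearning μ T x θstar ℱ it jt c)
    (θ : EuclideanSpace ℝ (Fin d)) {t : ℕ} (ht : t < T) :
    Measurable[ℱ t] fun ω => inner ℝ (pairDiff x it jt ω t) θ := by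
  have h1 := h.measurable_fst t ht
  have h2 := h.measurable_snd t ht
  have h3 : Measurable fun v : EuclideanSpace ℝ (Fin d) => inner ℝ v θ := by fun_prop
  exact h3.comp (h1.sub h2)

theorem IsActiveLearning.measurable_logLik (h : IsActiveLearning μ T x θstar ℱ it jt c)
    (θ : EuclideanSpace ℝ (Fin d)) {t : ℕ} (ht : t ≤ T) :
    Measurable[ℱ t] fun ω => logLik t (pairDiff x it jt ω) (fun s => c s ω) θ := by
  simp_rw [logLik_eq]
  refine Finset.measurable_fun_sum _ fun s hs => ?_
  have hst : s < t := Finset.mem_range.1 hs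
  have h1 := (h.measurable_inner θ (hst.trans_le ht)).mono (ℱ.mono hst.le) le_rfl
  have h2 := (h.measurable_feedback s (hst.trans_le ht)).mono (ℱ.mono hst) le_rfl
  have h3 : Measurable fun u : ℝ => Real.log (1 + Real.exp u) := by fun_prop
  exact (h2.mul h1).sub (h3.comp h1)

variable [IsProbabilityMeasure μ]

/-- The likelihood ratio of `θ` against the true parameter has mean one. -/
theorem IsActiveLearning.likelihoodRatio (h : IsActiveLearning μ T x θstar ℱ it jt c) {Q : ℝ}
    (hx : ∀ k, ‖x k‖ ≤ Q) (θ : EuclideanSpace ℝ (Fin d)) {t : ℕ} (ht : t ≤ T) :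
    Integrable (fun ω => Real.exp (logLik t (pairDiff x it jt ω) (fun s => c s ω) θ
        - logLik t (pairDiff x it jt ω) (fun s => c s ω) θstar)) μ ∧
      ∫ ω, Real.exp (logLik t (pairDiff x it jt ω) (fun s => c s ω) θ
        - logLik t (pairDiff x it jt ω) (fun s => c s ω) θstar) ∂μ = 1 := by
  set M := 2 * Q * ‖θ - θstar‖ with hM
  set W : ℕ → Ω → ℝ := fun t ω => Real.exp (logLik t (pairDiff x it jt ω) (fun s => c s ω) θ
        - logLik t (pairDiff x it jt ω) (fun s => c s ω) θstar) with hW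
  have hWmeas : ∀ t ≤ T, Measurable[ℱ t] (W t) := fun t ht =>
    Real.measurable_exp.comp ((h.measurable_logLik θ ht).sub (h.measurable_logLik θstar ht))
  have hWbound : ∀ t ≤ T, ∀ ω, ‖W t ω‖ ≤ Real.exp (t * M) := fun t ht ω => by
    rw [Real.norm_of_nonneg (Real.exp_pos _).le, hM]
    exact Real.exp_le_exp.2 (logLik_sub_le (fun s hs => h.binary s (hs.trans_le ht) ω)
      (norm_pairDiff_le hx ω) θ θstar)
  have hWint : ∀ t ≤ T, Integrable (W t) μ := fun t ht =>
    Integrable.of_bound ((hWmeas t ht).mono (ℱ.le t) le_rfl).aestronglyMeasurable _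
      (Filter.Eventually.of_forall (hWbound t ht))
  refine ⟨hWint t ht, ?_⟩
  change ∫ ω, W t ω ∂μ = 1
  induction t with
  | zero => simp [hW, logLik]
  | succ t ih =>
    have htT : t < T := ht
    specialize ih htT.le
    set u : Ω → ℝ := fun ω => inner ℝ (pairDiff x it jt ω t) θ with hu
    set b : Ω → ℝ := fun ω => inner ℝ (pairDiff x it jt ω t) θstar with hb
    have hum : Measurable[ℱ t] u := h.measurable_inner θ htT
    have hbm : Measurable[ℱ t] b := h.measurable_inner θstar htT
    -- `r₀` and `r₁` are the one-round ratios for feedback 0 and 1. Writing the realized ratio as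
    -- `r₀ + (r₁ - r₀) * ind` leaves `ind` as the only factor not known at time `t`.
    set r₀ : Ω → ℝ := fun ω => (1 - Real.sigmoid (u ω)) / (1 - Real.sigmoid (b ω)) with hr₀
    set r₁ : Ω → ℝ := fun ω => Real.sigmoid (u ω) / Real.sigmoid (b ω) with hr₁
    have hsm : Measurable Real.sigmoid := continuous_sigmoid.measurable
    have hr₀m : Measurable[ℱ t] r₀ :=
      ((measurable_const.sub (hsm.comp hum)).div (measurable_const.sub (hsm.comp hbm)))
    have hr₁m : Measurable[ℱ t] r₁ := (hsm.comp hum).div (hsm.comp hbm)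
    set A : Set Ω := {ω | c t ω = 1} with hA
    have hAm : MeasurableSet A :=
      (h.measurable_feedback t htT).mono (ℱ.le (t + 1)) le_rfl (measurableSet_singleton 1)
    set ind : Ω → ℝ := A.indicator (fun _ => (1 : ℝ)) with hind
    have hindint : Integrable ind μ := (integrable_const 1).indicator hAm
    have hlog0 : ∀ ω, r₀ ω = Real.exp (- Real.log (1 + Real.exp (u ω))
        + Real.log (1 + Real.exp (b ω))) := fun ω => by
      have h1 := Real.exp_pos (u ω)
      have h2 := Real.exp_pos (b ω)
      rw [Real.exp_add, Real.exp_neg, Real.exp_log (by positivity), Real.exp_log (by positivity)]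
      simp only [hr₀, one_sub_sigmoid_eq]
      field_simp
    have hlog1 : ∀ ω, r₁ ω = Real.exp (u ω - b ω - Real.log (1 + Real.exp (u ω))
        + Real.log (1 + Real.exp (b ω))) := fun ω => by
      have h1 := Real.exp_pos (u ω)
      have h2 := Real.exp_pos (b ω)
      rw [Real.exp_add, Real.exp_sub, Real.exp_sub, Real.exp_log (by positivity),
        Real.exp_log (by positivity)]
      simp only [hr₁, sigmoid_eq_exp_div]
      field_simp
    have hr₀bound : ∀ ω, |r₀ ω| ≤ Real.exp M := fun ω => by
      have h1 := log_bernoulli_sub_le (Or.inl rfl : (0 : ℝ) = 0 ∨ (0 : ℝ) = 1) (u ω) (b ω)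
      have h2 : |u ω - b ω| ≤ M := by
        rw [hu, hb, ← inner_sub_right]
        exact (abs_real_inner_le_norm _ _).trans (by
          rw [hM]; gcongr; exact norm_pairDiff_le hx ω t)
      rw [hlog0, Real.abs_exp]
      exact Real.exp_le_exp.2 (by linarith)
    have hstep : ∀ ω, W (t + 1) ω = (W t * r₀) ω + ((W t * (r₁ - r₀)) * ind) ω := fun ω => by
      have hW1 : W (t + 1) ω = W t ω * Real.exp ((c t ω * u ω - Real.log (1 + Real.exp (u ω)))
          - (c t ω * b ω - Real.log (1 + Real.exp (b ω)))) := by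
        simp only [hW, logLik_eq, Finset.sum_range_succ, hu, hb]
        rw [← Real.exp_add]
        ring_nf
      rw [hW1]
      simp only [Pi.mul_apply, Pi.sub_apply]
      rcases h.binary t htT ω with h0 | h1
      · have : ind ω = 0 := Set.indicator_of_notMem (by simp [hA, h0]) _
        rw [this, h0, hlog0]
        ring_nf
      · have : ind ω = 1 := Set.indicator_of_mem (by simp [hA, h1]) _
        rw [this, h1, show W t ω * r₀ ω + W t ω * (r₁ ω - r₀ ω) * 1 = W t ω * r₁ ω by ring, hlog1]
        ring_nf
    have hint0 : Integrable (W t * r₀) μ :=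
      (hWint t htT.le).mul_bdd (c := Real.exp M)
        (hr₀m.mono (ℱ.le t) le_rfl).aestronglyMeasurable (Filter.Eventually.of_forall hr₀bound)
    have hint1 : Integrable ((W t * (r₁ - r₀)) * ind) μ := by
      refine ((hWint (t + 1) ht).sub hint0).congr (Filter.Eventually.of_forall fun ω => ?_)
      show W (t + 1) ω - (W t * r₀) ω = _
      rw [hstep]; ring
    have hce : μ[(W t * (r₁ - r₀)) * ind | ℱ t] =ᵐ[μ] (W t * (r₁ - r₀)) * μ[ind | ℱ t] :=
      condExp_mul_of_stronglyMeasurable_left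
        ((hWmeas t htT.le).mul (hr₁m.sub hr₀m)).stronglyMeasurable hint1 hindint
    have hint1' : Integrable (μ[(W t * (r₁ - r₀)) * ind | ℱ t]) μ := integrable_condExp
    calc ∫ ω, W (t + 1) ω ∂μ
        = ∫ ω, ((W t * r₀) ω + ((W t * (r₁ - r₀)) * ind) ω) ∂μ := by simp_rw [hstep]
      _ = ∫ ω, (W t * r₀) ω ∂μ + ∫ ω, ((W t * (r₁ - r₀)) * ind) ω ∂μ := integral_add hint0 hint1
      _ = ∫ ω, (W t * r₀) ω ∂μ + ∫ ω, (μ[(W t * (r₁ - r₀)) * ind | ℱ t]) ω ∂μ := by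
          rw [integral_condExp (ℱ.le t)]
      _ = ∫ ω, ((W t * r₀) ω + (μ[(W t * (r₁ - r₀)) * ind | ℱ t]) ω) ∂μ :=
          (integral_add hint0 hint1').symm
      _ = ∫ ω, W t ω ∂μ := by
          refine integral_congr_ae ?_
          filter_upwards [hce, h.feedback t htT] with ω h1 h2
          rw [h1]
          have h2' : (μ[ind | ℱ t]) ω = Real.sigmoid (b ω) := h2
          -- The conditional mean of the one-round ratio is `(1 - σ(b)) r₀ + σ(b) r₁ = (1 - σ(u)) +
          -- σ(u) = 1`.
          simp only [Pi.mul_apply, Pi.sub_apply, h2', hr₀, hr₁]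
          have h3 := Real.sigmoid_pos (b ω)
          have h4 : 1 - Real.sigmoid (b ω) ≠ 0 := (sub_pos.2 (Real.sigmoid_lt_one (b ω))).ne'
          field_simp
          ring
      _ = 1 := ih

/-- Simultaneous control of the log-likelihood ratio over finitely many parameters. -/
theorem IsActiveLearning.measureReal_exists_le_logLik_sub
    (h : IsActiveLearning μ T x θstar ℱ it jt c) {Q : ℝ} (hx : ∀ k, ‖x k‖ ≤ Q)
    (G : Finset (EuclideanSpace ℝ (Fin d))) (y : ℝ) :
    μ.real {ω | ∃ θ ∈ G, y ≤ logLik T (pairDiff x it jt ω) (fun s => c s ω) θ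
        - logLik T (pairDiff x it jt ω) (fun s => c s ω) θstar} ≤ G.card * Real.exp (-y) := by
  have hset : {ω | ∃ θ ∈ G, y ≤ logLik T (pairDiff x it jt ω) (fun s => c s ω) θ
        - logLik T (pairDiff x it jt ω) (fun s => c s ω) θstar}
      = ⋃ θ ∈ G, {ω | Real.exp y ≤ Real.exp (logLik T (pairDiff x it jt ω) (fun s => c s ω) θ
        - logLik T (pairDiff x it jt ω) (fun s => c s ω) θstar)} := by
    ext ω
    simp
  rw [hset]
  refine (measureReal_biUnion_finset_le _ _).trans ?_
  rw [← nsmul_eq_mul]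
  refine Finset.sum_le_card_nsmul _ _ _ fun θ _ => ?_
  obtain ⟨hint, hone⟩ := h.likelihoodRatio hx θ le_rfl
  have hmark := mul_meas_ge_le_integral_of_nonneg
    (Filter.Eventually.of_forall fun ω => (Real.exp_pos _).le) hint (Real.exp y)
  rw [hone] at hmark
  rw [Real.exp_neg, ← one_div, le_div_iff₀ (Real.exp_pos _), mul_comm]
  exact hmark

end LikelihoodRatio

/-! ### Covering a ball by a grid -/

/-- A grid of mesh `1 / n` covering the ball of radius `R`. -/
theorem exists_grid (d n : ℕ) (hn : 1 ≤ n) (R : ℝ) (hR : 0 ≤ R) :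
    ∃ G : Finset (EuclideanSpace ℝ (Fin d)), (G.card : ℝ) ≤ ((2 * R + 3) * n) ^ d ∧
      ∀ θ : EuclideanSpace ℝ (Fin d), ‖θ‖ ≤ R → ∃ g ∈ G, ‖θ - g‖ ≤ d / n := by
  classical
  have hn0 : (0 : ℝ) < n := by exact_mod_cast hn
  set K : ℕ := ⌈R * n⌉₊ with hK
  have hKle : R * n ≤ K := Nat.le_ceil _
  have hKlt : (K : ℝ) < R * n + 1 := Nat.ceil_lt_add_one (by positivity)
  refine ⟨(Fintype.piFinset fun _ : Fin d => Finset.Icc (-(K : ℤ)) K).image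
    (fun k => WithLp.toLp 2 fun i => (k i : ℝ) / n), ?_, ?_⟩
  · have hcard : ((Fintype.piFinset fun _ : Fin d => Finset.Icc (-(K : ℤ)) K).card : ℝ)
        = (2 * K + 1) ^ d := by
      rw [Fintype.card_piFinset]
      simp only [Int.card_Icc, Finset.prod_const, Finset.card_univ, Fintype.card_fin]
      rw [show ((K : ℤ) + 1 - -(K : ℤ)).toNat = 2 * K + 1 by omega]
      push_cast
      rfl
    refine le_trans (Nat.cast_le.2 Finset.card_image_le) ?_
    rw [hcard]
    have : (1 : ℝ) ≤ n := by exact_mod_cast hn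
    gcongr
    linarith
  · intro θ hθ
    have hcoord : ∀ i, |θ i| ≤ R := fun i => by
      have := PiLp.norm_apply_le θ i
      rw [Real.norm_eq_abs] at this
      exact this.trans hθ
    refine ⟨_, Finset.mem_image_of_mem _ (a := fun i => round (θ i * n)) ?_, ?_⟩
    · rw [Fintype.mem_piFinset]
      intro i
      have h1 := abs_le.1 (hcoord i)
      have h2 : θ i * n ≤ K := (mul_le_mul_of_nonneg_right h1.2 hn0.le).trans hKle
      have h3 : -(K : ℝ) ≤ θ i * n := by
        have := mul_le_mul_of_nonneg_right h1.1 hn0.le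
        linarith
      have h4 := abs_le.1 (abs_sub_round (θ i * n))
      rw [Finset.mem_Icc]
      constructor
      · have : (-(K : ℤ) : ℝ) < (round (θ i * n) : ℝ) + 1 := by push_cast; linarith
        have : -(K : ℤ) < round (θ i * n) + 1 := by exact_mod_cast this
        omega
      · have : (round (θ i * n) : ℝ) < (K : ℤ) + 1 := by push_cast; linarith
        have : round (θ i * n) < (K : ℤ) + 1 := by exact_mod_cast this
        omega
    -- Rounding errs by at most `1 / (2 n)` per coordinate. The Euclidean norm is bounded by the sum
    -- of the coordinate errors, which is crude but costs only a logarithm later.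
    · have hle : ‖θ - WithLp.toLp 2 fun i => ((round (θ i * n) : ℤ) : ℝ) / n‖
          ≤ ∑ _i : Fin d, 1 / (n : ℝ) := by
        rw [EuclideanSpace.norm_eq]
        refine (Real.sqrt_le_sqrt (Finset.sum_le_sum
          (g := fun _ => (1 / (n : ℝ)) ^ 2) fun i _ => ?_)).trans ?_
        · rw [Real.norm_eq_abs]
          gcongr
          have h4 := abs_sub_round (θ i * n)
          rw [PiLp.sub_apply, show θ i - ((round (θ i * n) : ℤ) : ℝ) / n
            = (θ i * n - (round (θ i * n) : ℤ)) / n by field_simp, abs_div, abs_of_pos hn0]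
          gcongr
          linarith
        · rw [Real.sqrt_le_left (by positivity)]
          exact Finset.sum_sq_le_sq_sum_of_nonneg fun _ _ => by positivity
      refine hle.trans (le_of_eq ?_)
      simp [div_eq_mul_inv]

/-! ### From Fisher-weighted error to win probabilities -/

/-- Take logarithms and clear the denominator. For `q = 0` the conclusion is just `0 ≤ p`, so a pair
with `v = 0` needs no separate treatment. -/
theorem mul_neg_log_le_of_exp_le {p q a : ℝ} (hp : 0 ≤ p) (hq : 0 ≤ q) (ha : 0 < a)
    (h : Real.exp (-p / q) ≤ a) : q * (-Real.log a) ≤ p := by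
  rcases hq.eq_or_lt with rfl | hq
  · simpa using hp
  · have h1 := (Real.le_log_iff_exp_le ha).2 h
    rw [neg_div, neg_le, le_div_iff₀ hq] at h1
    linarith

/-- If the Fisher-weighted squared error of `θ` is at most `D d l`, then on the event that
`alphaTerm` and `betaTerm` with constant `2 D` are at most `exp (-l)`, the win probability is
estimated up to an error less than `Δ`. -/
theorem abs_sigmoid_sub_lt_of_terms_le {d T : ℕ} (hT : 1 ≤ T)
    {z : ℕ → EuclideanSpace ℝ (Fin d)} {θ θ₀ v : EuclideanSpace ℝ (Fin d)} {D l a b Δ : ℝ}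
    (hD : 0 < D) (hΔ : 0 < Δ) (ha : 0 < a) (hb : 0 < b)
    (hla : l ≤ -Real.log a) (hlb : l ≤ -Real.log b)
    (hdet : IsUnit (hessian T z θ).det)
    (hX : ∑ s ∈ Finset.range T,
      deriv Real.sigmoid (inner ℝ (z s) θ) * (inner ℝ (z s) (θ - θ₀)) ^ 2 ≤ D * d * l)
    (hα : alphaTerm (2 * D) T z θ v Δ ≤ a) (hβ : betaTerm (2 * D) T z θ v Δ ≤ b) :
    |Real.sigmoid (inner ℝ v θ₀) - Real.sigmoid (inner ℝ v θ)| < Δ := by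
  have hT0 : (0 : ℝ) < T := by exact_mod_cast hT
  set N := weightedNorm (hessian T z θ)⁻¹ v ^ 2 with hN
  have hN0 : 0 ≤ N := sq_nonneg _
  set g := deriv Real.sigmoid (inner ℝ v θ) with hg
  have hg0 : 0 < g := deriv_sigmoid_pos _
  have hCS := inner_sq_le_weightedNorm_inv_sq_mul hdet v (θ - θ₀)
  rw [← hN, inner_sub_right] at hCS
  set m := |inner ℝ v θ₀ - inner ℝ v θ| with hm
  have hm2 : m ^ 2 ≤ N * (D * d * l) := by
    rw [hm, sq_abs, ← neg_sub, neg_sq]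
    exact hCS.trans (mul_le_mul_of_nonneg_left hX hN0)
  have hα' := mul_neg_log_le_of_exp_le (by positivity) (by positivity) ha hα
  have hβ' := mul_neg_log_le_of_exp_le (by positivity) (by positivity) hb hβ
  rw [← hg, mul_pow, weightedNorm_inv_normHessian_sq hT hdet, ← hN] at hα'
  rw [weightedNorm_inv_normHessian_sq hT hdet, ← hN] at hβ'
  -- The factor `T` from inverting the normalized Hessian cancels the `T` in the exponent; `16` is
  -- `8` times the `2` of `2 * D`.
  have hα2 : 16 * (d * D * g ^ 2 * N * l) ≤ Δ ^ 2 := by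
    have h1 : (8 * d * (2 * D) * (g ^ 2 * (T * N))) * l ≤ Δ ^ 2 * T :=
      (mul_le_mul_of_nonneg_left hla (by positivity)).trans hα'
    refine le_of_mul_le_mul_right ?_ hT0
    linarith
  have hβ2 : 2 * (d * D * N * l) ≤ Δ := by
    have h1 : (d * (2 * D) * (T * N)) * l ≤ Δ * T :=
      (mul_le_mul_of_nonneg_left hlb (by positivity)).trans hβ'
    refine le_of_mul_le_mul_right ?_ hT0
    linarith
  have hfirst : g * m ≤ Δ / 4 := by
    refine abs_le_of_sq_le_sq' ?_ (by positivity) |>.2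
    have := mul_le_mul_of_nonneg_left hm2 (sq_nonneg g)
    rw [mul_pow]
    linarith
  have htaylor := abs_sigmoid_sub_le_deriv (inner ℝ v θ₀) (inner ℝ v θ)
  rw [← hm, ← hg, ← sq_abs (_ - _), ← hm] at htaylor
  -- The linear term is at most `Δ / 4` and the quadratic term, by `hm2` and `hβ2`, at most `Δ / 2`.
  linarith

/-! ### Uniform control of the likelihood gain on a ball -/

/-- With probability at least `1 - g`, the log-likelihood of every parameter in a ball of radius
`A T` exceeds that of the true parameter by at most `O (d log (1 / g))`. -/
theorem IsActiveLearning.exists_logLik_sub_le {d T : ℕ} (hd : 1 ≤ d) (hT : 1 ≤ T)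
    {I Ω : Type*} [mΩ : MeasurableSpace Ω] {μ : Measure Ω} [IsProbabilityMeasure μ]
    {x : I → EuclideanSpace ℝ (Fin d)} {θstar : EuclideanSpace ℝ (Fin d)}
    {ℱ : Filtration ℕ mΩ} {it jt : ℕ → Ω → I} {c : ℕ → Ω → ℝ}
    (h : IsActiveLearning μ T x θstar ℱ it jt c) {Q A g : ℝ} (hQ : 0 < Q) (hA : 0 < A)
    (hx : ∀ k, ‖x k‖ ≤ Q) (hg0 : 0 < g) (hg : g ≤ 1 / (4 * d * T)) :
    ∃ E : Set Ω, μ.real E ≤ g ∧ ∀ ω ∉ E, ∀ θ : EuclideanSpace ℝ (Fin d), ‖θ‖ ≤ A * T →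
      logLik T (pairDiff x it jt ω) (fun s => c s ω) θ
        - logLik T (pairDiff x it jt ω) (fun s => c s ω) θstar
        ≤ (Real.log (2 * A + 3) + 3 + 2 * Q) * d * (-Real.log g) := by
  have hd1 : (1 : ℝ) ≤ d := by exact_mod_cast hd
  have hT1 : (1 : ℝ) ≤ T := by exact_mod_cast hT
  have hdT : (1 : ℝ) ≤ d * T := by nlinarith
  set l := -Real.log g with hl
  -- The cap `1 / (4 d T)` on `g` is what lets `l` absorb the grid entropy; the summand 1 comes from
  -- `exp 1 ≤ 4`.
  have hl1 : 1 + Real.log (d * T) ≤ l := by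
    have h1 : Real.log (4 * (d * T)) ≤ l := by
      rw [hl, ← Real.log_inv]
      apply Real.log_le_log (by positivity)
      rw [le_inv_comm₀ (by positivity) hg0, ← mul_assoc, ← one_div]
      exact hg
    have h2 : (1 : ℝ) ≤ Real.log 4 := by
      rw [Real.le_log_iff_exp_le (by norm_num)]
      linarith [Real.exp_one_lt_d9]
    rw [Real.log_mul (by norm_num) (by positivity)] at h1
    linarith
  have hlogdT : 0 ≤ Real.log (d * T) := Real.log_nonneg hdT
  have hκ : 0 ≤ Real.log (2 * A + 3) := Real.log_nonneg (by linarith)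
  -- Mesh `1 / (d T)` gives covering distance `1 / T`, so the Lipschitz constant `2 Q T` costs only
  -- `2 Q`.
  obtain ⟨G, hGcard, hGcov⟩ := exists_grid d (d * T) (by nlinarith) (A * T) (by positivity)
  -- The first summand bounds the logarithm of the grid's cardinality, so the union bound leaves
  -- `exp (-l) = g`.
  set y := d * (Real.log (2 * A + 3) + 2 * Real.log (d * T)) + l with hy
  refine ⟨_, (h.measureReal_exists_le_logLik_sub hx G y).trans ?_, fun ω hω θ hθ => ?_⟩
  · have hcard : (G.card : ℝ) ≤ Real.exp (d * (Real.log (2 * A + 3) + 2 * Real.log (d * T))) := by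
      refine hGcard.trans ?_
      rw [Real.exp_nat_mul, Real.exp_add, Real.exp_log (by positivity),
        show 2 * Real.log (d * T) = Real.log (d * T) + Real.log (d * T) by ring, Real.exp_add,
        Real.exp_log (by positivity)]
      push_cast
      refine pow_le_pow_left₀ (by positivity) ?_ d
      rw [← mul_assoc (2 * A + 3)]
      refine mul_le_mul_of_nonneg_right ?_ (by positivity : (0 : ℝ) ≤ d * T)
      have h1 : (T : ℝ) ≤ d * T := by nlinarith
      calc 2 * (A * T) + 3 ≤ (2 * A + 3) * T := by linarith
        _ ≤ _ := by gcongr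
    calc (G.card : ℝ) * Real.exp (-y)
        ≤ Real.exp (d * (Real.log (2 * A + 3) + 2 * Real.log (d * T))) * Real.exp (-y) := by gcongr
      _ = g := by
          rw [← Real.exp_add, hy, hl]
          ring_nf
          exact Real.exp_log hg0
  · obtain ⟨p, hpG, hp⟩ := hGcov θ hθ
    simp only [Set.mem_ofPred_eq, not_exists, not_and, not_le] at hω
    have h1 := hω p hpG
    have h2 := logLik_sub_le (fun s hs => h.binary s hs ω) 
      (norm_pairDiff_le (it := it) (jt := jt) hx ω) θ p
    have h3 : (T : ℝ) * (2 * Q * ‖θ - p‖) ≤ 2 * Q := by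
      have h4 : ‖θ - p‖ ≤ 1 / T := by
        refine hp.trans (le_of_eq ?_)
        push_cast
        field_simp
      calc (T : ℝ) * (2 * Q * ‖θ - p‖) ≤ T * (2 * Q * (1 / T)) := by gcongr
        _ = 2 * Q := by field_simp
    have hl0 : 1 ≤ l := by linarith
    have hdl : 1 ≤ d * l := by nlinarith
    have h5 : d * Real.log (2 * A + 3) ≤ d * Real.log (2 * A + 3) * l :=
      le_mul_of_one_le_right (by positivity) hl0
    have h6 : d * Real.log (d * T) ≤ d * l := by gcongr; linarith
    have h7 : l ≤ d * l := le_mul_of_one_le_left (by linarith) hd1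
    have h8 : 2 * Q ≤ 2 * Q * (d * l) := le_mul_of_one_le_right (by linarith) hdl
    rw [hy] at h1
    linarith

end PrefOrder

/-! ### The concentration lemma -/

open PrefOrder

theorem lemma1 (S lam₀ Q : ℝ) (hS : 0 < S) (hlam₀ : 0 < lam₀) (hQ : 0 < Q) :
    ∃ C₁ : ℝ, 0 < C₁ ∧
      ∀ (d T : ℕ), 1 ≤ d → 1 ≤ T →
      ∀ (I Ω : Type*) [mΩ : MeasurableSpace Ω] (μ : Measure Ω) [IsProbabilityMeasure μ]
        (x : I → EuclideanSpace ℝ (Fin d)) (θstar : EuclideanSpace ℝ (Fin d))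
        (ℱ : Filtration ℕ mΩ) (it jt : ℕ → Ω → I) (c : ℕ → Ω → ℝ)
        (θT : Ω → EuclideanSpace ℝ (Fin d)),
        PrefOrder.IsActiveLearning μ T x θstar ℱ it jt c →
        ‖θstar‖ ≤ S →
        (∀ k, ‖x k‖ ≤ Q) →
        ∀ (i j : I) (Δ : ℝ), 0 < Δ →
        ∀ a b : ℝ, 0 < a → a ≤ 1 / (4 * d * T) → 0 < b → b ≤ 1 / (4 * d * T) →
          μ.real {ω |
              PrefOrder.IsMLE T (PrefOrder.pairDiff x it jt ω) (fun s => c s ω) (θT ω) ∧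
              PrefOrder.FullRankEigenvaluesGT
                (PrefOrder.hessian T (PrefOrder.pairDiff x it jt ω) (θT ω)) lam₀ ∧
              PrefOrder.FullRankEigenvaluesGT
                (PrefOrder.hessian T (PrefOrder.pairDiff x it jt ω) θstar) lam₀ ∧
              PrefOrder.alphaTerm C₁ T (PrefOrder.pairDiff x it jt ω) (θT ω) (x i - x j) Δ ≤ a ∧
              PrefOrder.betaTerm C₁ T (PrefOrder.pairDiff x it jt ω) (θT ω) (x i - x j) Δ ≤ b ∧
              Δ < |Real.sigmoid (inner ℝ (x i - x j) θstar)
                    - Real.sigmoid (inner ℝ (x i - x j) (θT ω))|}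
            ≤ 2 * d * T * (a + b) := by
  -- `2 / lam₀` and `1` come from `‖θT‖ ^ 2 ≤ 2 T / lam₀` and `t ≤ t ^ 2 + 1`, and `S` from `θstar`;
  -- as `T ≥ 1`, the ball of radius `A T` contains the midpoint.
  set A := 2 / lam₀ + 1 + S with hA
  have hA0 : 0 < A := by positivity
  have hκ : 0 ≤ Real.log (2 * A + 3) := Real.log_nonneg (by linarith)
  -- The Jensen-gap constant with `B = 2 Q S`, times the constant of the uniform likelihood bound.
  set D := 8 * (1 + Real.exp (2 * Q * S)) * (Real.log (2 * A + 3) + 3 + 2 * Q) with hD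
  have hD0 : 0 < D := by positivity
  refine ⟨2 * D, by positivity, ?_⟩
  intro d T hd hT I Ω mΩ μ _ x θstar ℱ it jt c θT h hθstar hx i j Δ hΔ a b ha0 ha hb0 hb
  have hd1 : (1 : ℝ) ≤ d := by exact_mod_cast hd
  have hT1 : (1 : ℝ) ≤ T := by exact_mod_cast hT
  have hdT : (1 : ℝ) ≤ d * T := by nlinarith
  -- The exceptional set is fixed without reference to `θT` and works for all parameters of the ball
  -- at once, so the estimate may depend on the outcome arbitrarily.
  obtain ⟨E, hE, hgood⟩ := h.exists_logLik_sub_le hd hT hQ hA0 hx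
    (lt_max_of_lt_left ha0 : 0 < max a b) (max_le ha hb)
  have hg0 : 0 < max a b := lt_max_of_lt_left ha0
  refine (measureReal_mono (h₂ := measure_ne_top μ E) fun ω hω => ?_).trans (hE.trans ?_)
  · obtain ⟨hmle, hH, -, hα, hβ, hdev⟩ := hω
    by_contra hωE
    have hnorm := mul_norm_sq_le_of_fullRankEigenvaluesGT hH
    have hθ : ‖θT ω‖ ≤ 2 / lam₀ * T + 1 := by
      have h1 : ‖θT ω‖ ^ 2 ≤ 2 / lam₀ * T := by
        rw [div_mul_eq_mul_div, le_div_iff₀ hlam₀]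
        linarith
      nlinarith [sq_nonneg (‖θT ω‖ - 1)]
    have hmid : ‖(1 / 2 : ℝ) • (θT ω + θstar)‖ ≤ A * T := by
      rw [norm_smul, Real.norm_of_nonneg (by norm_num)]
      have h1 := norm_add_le (θT ω) θstar
      have h2 : 0 ≤ 2 / lam₀ * T := by positivity
      rw [hA]
      nlinarith
    have hB : ∀ s, |inner ℝ (pairDiff x it jt ω s) θstar| ≤ 2 * Q * S := fun s =>
      (abs_real_inner_le_norm _ _).trans
        (mul_le_mul (norm_pairDiff_le hx ω s) hθstar (norm_nonneg _) (by positivity))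
    have hX := (hmle.sum_deriv_sigmoid_mul_sq_le hB).trans
      (mul_le_mul_of_nonneg_left (hgood ω hωE _ hmid) (by positivity))
    refine hdev.not_ge (abs_sigmoid_sub_lt_of_terms_le hT hD0
      hΔ ha0 hb0
      (neg_le_neg (Real.log_le_log ha0 (le_max_left a b)))
      (neg_le_neg (Real.log_le_log hb0 (le_max_right a b)))
      (isUnit_det_of_fullRankEigenvaluesGT (isHermitian_hessian _ _ _) hlam₀ hH)
      (hX.trans (le_of_eq ?_)) hα hβ).le
    rw [hD]
    ring
  -- Since `d T ≥ 1`, the bound `a + b` is already below `2 d T (a + b)`.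
  · have h1 : max a b ≤ a + b := max_le (by linarith) (by linarith)
    nlinarith
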